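/- For an object $G$ of a category with zero morphisms and a set $X$, let $G^{(X)}$ and $G^X$ denote the coproduct and the product of $X$ copies of $G$ (when they exist), let $\eta_{G,X}\colon G^{(X)}\to G^X$ be the canonical morphism (its $(x,y)$-component is $\mathrm{id}_G$ if $x=y$ and $0$ otherwise), let $\Delta_{G,X}\colon G\to G^X$ be the diagonal morphism, and let $s_{G,X}\colon G^{(X)}\to G$ be the summation morphism, i.e. the morphism whose components are all $\mathrm{id}_G$. Let $\mathcal B$ be an abelian category with (set-indexed) coproducts and a projective generator $P$. Then $\mathcal B$ is complete, and the following conditions are equivalent: (i) inverse (i.e. cofiltered) limits are exact in $\mathcal B$ (axiom Ab5*); (ii) the canonical morphism $\eta_{P,X}\colon P^{(X)}\to P^X$ is an epimorphism for every set $X$; (iii) for every set $X$ the diagonal morphism $\Delta_{P,X}\colon P\to P^X$ factors through $\eta_{P,X}$, i.e. there is $t\colon P\to P^{(X)}$ with $\eta_{P,X}\circ t=\Delta_{P,X}$. Dually, let $\mathcal A$ be an abelian category with (set-indexed) products (equivalently, a complete abelian category) and an injective cogenerator $J$. Then $\mathcal A$ is cocomplete, and the following conditions are equivalent: (i') filtered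 colimits are exact in $\mathcal A$ (axiom Ab5); (ii') the canonical morphism $\eta_{J,X}\colon J^{(X)}\to J^X$ is a monomorphism for every set $X$; (iii') for every set $X$ the summation morphism $s_{J,X}\colon J^{(X)}\to J$ factors through $\eta_{J,X}$, i.e. there is $r\colon J^X\to J$ with $r\circ\eta_{J,X}=s_{J,X}$. -/

import Mathlib

open CategoryTheory CategoryTheory.Limits

universe v u

noncomputable section

open scoped Classical in
/-- The canonical morphism `G^(X) ⟶ G^X` from the coproduct to the product of `X` copies of `G`:
its `(x, y)` matrix entry is the identity if `x = y` and zero otherwise. -/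
def copowerToPower {C : Type u} [Category.{v} C] [HasZeroMorphisms C] (G : C) (X : Type v)
    [HasCoproduct fun _ : X => G] [HasProduct fun _ : X => G] :
    (∐ fun _ : X => G) ⟶ (∏ᶜ fun _ : X => G) :=
  Sigma.desc fun x => Pi.lift fun y => if x = y then 𝟙 G else 0

/-- The diagonal morphism `G ⟶ G^X`. -/
def diagonalToPower {C : Type u} [Category.{v} C] (G : C) (X : Type v)
    [HasProduct fun _ : X => G] : G ⟶ (∏ᶜ fun _ : X => G) :=
  Pi.lift fun _ => 𝟙 G

/-- The summation (codiagonal) morphism `G^(X) ⟶ G`. -/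
def copowerSummation {C : Type u} [Category.{v} C] (G : C) (X : Type v)
    [HasCoproduct fun _ : X => G] : (∐ fun _ : X => G) ⟶ G :=
  Sigma.desc fun _ => 𝟙 G

end

/-! The hard implication is (iii) ⇒ (i). A factorization `t` gives natural additive sums of
`X`-indexed families of morphisms out of `P`, correct on families with one nonzero term. Over a
well-order, every family is the family of partial sums of a series; the total of that series is a
linear, natural generalized limit which returns the eventual value of an eventually constant family
(`admitsEventualValue_atTop_of_wellOrder`). Transfinite induction extends such limits to all
directed sets. Applied to incompatible liftings along a levelwise epimorphism they produce a
compatible one (`HasSummation.epi_of_isLimit`), so inverse limits preserve epimorphisms. (i) ⇒ (ii)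
reduces to finite subsets of `X`, and (ii) ⇒ (iii) is projectivity. The dual half applies the same
lifting lemma in the opposite category. -/

open Opposite

/-! ### Generalized limits along filters. -/

section EventualValue

variable {C : Type u} [Category.{v} C] [HasCoproducts.{v} C]

/-- The object `P` admits values along the filter `F` on `I` if there is a natural way of assigning
to every family of morphisms `I → (P ⟶ D)` a morphism `P ⟶ D`, which on families that are
eventually constant along `F` is the eventual value. By the Yoneda lemma this amounts to a morphism
from `P` to the coproduct of `I` copies of `P`. -/
def AdmitsEventualValue (P : C) {I : Type v} (F : Filter I) : Prop :=
  ∃ l : P ⟶ ∐ fun _ : I => P, ∀ ⦃D : C⦄ (b : I → (P ⟶ D)) (c : P ⟶ D),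
    (∀ᶠ i in F, b i = c) → l ≫ Sigma.desc b = c

lemma AdmitsEventualValue.of_tendsto {P : C} {I J : Type v} {F : Filter I} {G : Filter J}
    (h : AdmitsEventualValue P F) {f : I → J} (hf : Filter.Tendsto f F G) :
    AdmitsEventualValue P G := by
  obtain ⟨l, hl⟩ := h
  refine ⟨l ≫ Sigma.desc fun i => Sigma.ι (fun _ : J => P) (f i), fun D b c hb => ?_⟩
  have : (Sigma.desc fun i => Sigma.ι (fun _ : J => P) (f i)) ≫ Sigma.desc b =
      Sigma.desc (b ∘ f) := by
    ext; simp
  rw [Category.assoc, this]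
  exact hl _ _ (hf.eventually hb)

lemma AdmitsEventualValue.bind {P : C} {K I : Type v} {F : Filter K} {G : K → Filter I}
    {H : Filter I} (hF : AdmitsEventualValue P F) (hG : ∀ k, AdmitsEventualValue P (G k))
    (hH : F.bind G ≤ H) : AdmitsEventualValue P H := by
  obtain ⟨l, hl⟩ := hF
  choose m hm using hG
  refine ⟨l ≫ Sigma.desc m, fun D b c hb => ?_⟩
  have : Sigma.desc m ≫ Sigma.desc b = Sigma.desc fun k => m k ≫ Sigma.desc b := by
    ext; simp
  rw [Category.assoc, this]
  refine hl _ _ ?_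
  have hb' : ∀ᶠ k in F, ∀ᶠ i in G k, b i = c := hH hb
  filter_upwards [hb'] with k hk using hm k b c hk

lemma admitsEventualValue_pure (P : C) {I : Type v} (i : I) :
    AdmitsEventualValue P (pure i : Filter I) :=
  ⟨Sigma.ι (fun _ : I => P) i, fun D b c hb => by simpa using hb⟩

end EventualValue

/-! ### From summation operations to limits along directed sets. -/

section Summation

variable {C : Type u} [Category.{v} C] [Preadditive C] [HasCoproducts.{v} C]

lemma sigmaDesc_add {X : Type v} {P D : C} (a b : X → (P ⟶ D)) :
    Sigma.desc (a + b) = Sigma.desc a + Sigma.desc b := by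
  ext; simp

variable {P : C} {X : Type v}

-- The morphism out of the copower is `copowerToPower` followed by the projection to `x` and by `a`;
-- the diagonal composed with that projection is the identity.
open scoped Classical in
lemma comp_sigmaDesc_single [HasProduct fun _ : X => P] {t : P ⟶ ∐ fun _ : X => P}
    (ht : t ≫ copowerToPower P X = diagonalToPower P X) {D : C} (x : X) (a : P ⟶ D) :
    t ≫ Sigma.desc (Pi.single x a : X → (P ⟶ D)) = a := by
  have : Sigma.desc (Pi.single x a : X → (P ⟶ D)) =
      copowerToPower P X ≫ Pi.π (fun _ : X => P) x ≫ a := by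
    ext y
    by_cases h : y = x
    · subst h
      simp [copowerToPower]
    · simp [copowerToPower, h]
  rw [this, reassoc_of% ht]
  simp [diagonalToPower]

/-- For a well-ordered set, the partial sums of a family of morphisms can be prescribed at will: the
terms are found recursively. -/
lemma admitsEventualValue_atTop_of_wellOrder [LinearOrder X] [WellFoundedLT X] [Nonempty X]
    (t : P ⟶ ∐ fun _ : X => P)
    (ht : ∀ ⦃D : C⦄ (x : X) (a : P ⟶ D), t ≫ Sigma.desc (Pi.single x a : X → (P ⟶ D)) = a) :
    AdmitsEventualValue P (Filter.atTop : Filter X) := by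
  -- The universal series: its partial sum over `z ≤ x` is the coprojection at `x`. Composing with
  -- `Sigma.desc b` gives a series with partial sums `b`.
  let y : X → (P ⟶ ∐ fun _ : X => P) := WellFoundedLT.fix fun x rec =>
    Sigma.ι (fun _ : X => P) x - t ≫ Sigma.desc fun z => if h : z < x then rec z h else 0
  have hy (x : X) : y x = Sigma.ι (fun _ : X => P) x -
      t ≫ Sigma.desc fun z => if z < x then y z else 0 := by
    simp only [y]
    rw [WellFoundedLT.fix_eq]
    simp
  refine ⟨t ≫ Sigma.desc y, fun D b c hb => ?_⟩
  obtain ⟨x₀, hx₀⟩ := Filter.eventually_atTop.1 hb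
  let w : X → (P ⟶ D) := fun x => y x ≫ Sigma.desc b
  have hw (x : X) : (t ≫ Sigma.desc fun z => if z < x then w z else 0) + w x = b x := by
    have : (Sigma.desc fun z => if z < x then y z else 0) ≫ Sigma.desc b =
        Sigma.desc fun z => if z < x then w z else 0 := by
      ext z
      by_cases h : z < x <;> simp [h, w]
    simp only [w] at this ⊢
    rw [← this, ← Category.assoc, ← Preadditive.add_comp]
    rw [eq_sub_iff_add_eq'.1 (hy x)]
    simp
  have hw' (x : X) : (t ≫ Sigma.desc fun z => if z ≤ x then w z else 0) = b x := by
    have : (fun z => if z ≤ x then w z else 0) =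
        (fun z => if z < x then w z else 0) + Pi.single x (w x) := by
      ext z
      rcases lt_trichotomy z x with h | rfl | h
      · simp [h, h.le, h.ne]
      · simp
      · simp [h.not_ge, h.not_gt, h.ne']
    rw [this, sigmaDesc_add, Preadditive.comp_add, ht, hw]
  -- By induction the sum over `z < x` stops at `x₀`, so it is `b x₀ = b x` and leaves nothing for
  -- the term at `x`.
  have hzero (x : X) : x₀ < x → w x = 0 := by
    induction x using WellFoundedLT.induction with
    | _ x ih =>
      intro hx
      have : (fun z => if z < x then w z else 0) = fun z => if z ≤ x₀ then w z else 0 := by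
        ext z
        by_cases h : z ≤ x₀
        · simp [h, h.trans_lt hx]
        · by_cases h' : z < x
          · simp [h, ih z h' (not_le.1 h)]
          · simp [h, h']
      have key := hw x
      rw [this, hw', hx₀ x₀ le_rfl, hx₀ x hx.le] at key
      simpa using key
  have : Sigma.desc y ≫ Sigma.desc b = Sigma.desc fun z => if z ≤ x₀ then w z else 0 := by
    ext z
    by_cases h : z ≤ x₀
    · simp [h, w]
    · simp [h, ← hzero z (not_le.1 h), w]
  rw [Category.assoc, this, hw', hx₀ x₀ le_rfl]

/-- The filter on the finite subsets of `X` generated by the conditions `x ∈ A` for `x ∈ s`. -/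
def finsetsContaining (s : Set X) : Filter (Finset X) :=
  ⨅ x ∈ s, Filter.principal {A | x ∈ A}

lemma le_finsetsContaining {s : Set X} {F : Filter (Finset X)} :
    F ≤ finsetsContaining s ↔ ∀ x ∈ s, ∀ᶠ A in F, x ∈ A := by
  simp [finsetsContaining, Filter.Eventually]

lemma eventually_mem_finsetsContaining {s : Set X} {x : X} (hx : x ∈ s) :
    ∀ᶠ A in finsetsContaining s, x ∈ A :=
  le_finsetsContaining.1 le_rfl x hx

variable (P) in
open scoped Classical in
/-- There are natural summation operations on families of morphisms out of `P`, which give back `a`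
on a family with `a` as its only nonzero member. -/
def HasSummation : Prop :=
  ∀ X : Type v, ∃ t : P ⟶ ∐ fun _ : X => P, ∀ ⦃D : C⦄ (x : X) (a : P ⟶ D),
    t ≫ Sigma.desc (Pi.single x a : X → (P ⟶ D)) = a

-- Iterated limit: for `k ∈ s`, run over sets that eventually contain each element below `k`, with
-- `k` inserted; then let `k` increase in `s`. A given `x ∈ s` is captured as soon as `k ≥ x`.
open scoped Classical in
lemma AdmitsEventualValue.finsetsContaining_of_forall_lt [LinearOrder X] [WellFoundedLT X]
    (hP : HasSummation P) {s : Set X}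
    (h : ∀ x ∈ s, AdmitsEventualValue P (finsetsContaining (Set.Iio x))) :
    AdmitsEventualValue P (finsetsContaining s) := by
  rcases s.eq_empty_or_nonempty with rfl | hs
  · exact (admitsEventualValue_pure P ∅).of_tendsto (f := id)
      (le_finsetsContaining.2 fun x hx => absurd hx (Set.notMem_empty x))
  have : Nonempty s := hs.to_subtype
  obtain ⟨t, ht⟩ := hP s
  refine (admitsEventualValue_atTop_of_wellOrder t
    fun D x a => by convert ht x a).bind
    (G := fun x : s => (finsetsContaining (Set.Iio x.1)).map (insert x.1))
    (fun x => (h x.1 x.2).of_tendsto Filter.tendsto_map) (le_finsetsContaining.2 fun x hx => ?_)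
  refine Filter.eventually_bind.2 ?_
  filter_upwards [Filter.eventually_ge_atTop (⟨x, hx⟩ : s)] with k hk
  change ∀ᶠ A in finsetsContaining (Set.Iio k.1), x ∈ insert k.1 A
  rcases (show x ≤ k.1 from hk).eq_or_lt with rfl | hlt
  · simp
  · filter_upwards [eventually_mem_finsetsContaining (s := Set.Iio k.1) hlt] with A hA
    exact Finset.mem_insert_of_mem hA

lemma HasSummation.admitsEventualValue_finsetsContaining (hP : HasSummation P) (s : Set X) :
    AdmitsEventualValue P (finsetsContaining s) := by
  obtain ⟨_, _⟩ := exists_wellFoundedLT X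
  have h (x : X) : AdmitsEventualValue P (finsetsContaining (Set.Iio x)) := by
    induction x using WellFoundedLT.induction with
    | _ x ih => exact .finsetsContaining_of_forall_lt hP ih
  exact .finsetsContaining_of_forall_lt hP fun x _ => h x

/-- Choosing upper bounds of finite subsets maps the filter on `Finset I` to `atTop`. -/
lemma HasSummation.admitsEventualValue_atTop (hP : HasSummation P) (I : Type v) [Preorder I]
    [IsDirected I (· ≤ ·)] [Nonempty I] : AdmitsEventualValue P (Filter.atTop : Filter I) := by
  choose f hf using fun A : Finset I => A.exists_le
  refine (hP.admitsEventualValue_finsetsContaining (X := I) Set.univ).of_tendsto (f := f)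
    (Filter.tendsto_atTop.2 fun i => ?_)
  filter_upwards [eventually_mem_finsetsContaining (Set.mem_univ i)] with A hA using hf A i hA

end Summation

/-! ### Lifting through inverse limits. -/

section Lim

variable {C : Type u} [Category.{v} C] [Preadditive C] [HasCoproducts.{v} C] {P : C}

open scoped Classical in
/-- Morphisms from `P` lift along a levelwise epimorphism of inverse systems: the liftings to the
individual levels are made compatible by passing to eventual values. -/
lemma HasSummation.epi_of_isLimit [Projective P] (hP : HasSummation P) (hsep : IsSeparator P)
    {I : Type v} [Preorder I] [IsDirected I (· ≤ ·)] [Nonempty I] {K L : Iᵒᵖ ⥤ C} (φ : K ⟶ L)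
    [∀ i, Epi (φ.app i)] {c : Cone K} (hc : IsLimit c) {d : Cone L} (hd : IsLimit d)
    (f : c.pt ⟶ d.pt) (hf : ∀ i, f ≫ d.π.app i = c.π.app i ≫ φ.app i) : Epi f := by
  suffices h : ∀ e : P ⟶ d.pt, ∃ g : P ⟶ c.pt, g ≫ f = e by
    refine ⟨fun u v huv => hsep.def _ _ fun e => ?_⟩
    obtain ⟨g, rfl⟩ := h e
    simp [huv]
  intro e
  obtain ⟨l, hl⟩ := hP.admitsEventualValue_atTop I
  let g (i : Iᵒᵖ) : P ⟶ K.obj i := Projective.factorThru (e ≫ d.π.app i) (φ.app i)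
  have hg (i : Iᵒᵖ) : g i ≫ φ.app i = e ≫ d.π.app i := Projective.factorThru_comp _ _
  -- The lifting at level `j`, pushed down to level `i`; the default 0 is harmless because
  -- eventually `i ≤ j`.
  let b (i : Iᵒᵖ) (j : I) : P ⟶ K.obj i :=
    if h : i.unop ≤ j then g (op j) ≫ K.map (homOfLE h).op else 0
  have hcomp (i i' : Iᵒᵖ) (k : i ⟶ i') :
      (l ≫ Sigma.desc (b i)) ≫ K.map k = l ≫ Sigma.desc (b i') := by
    have hk : i'.unop ≤ i.unop := leOfHom k.unop
    -- The family `b i` need not be eventually constant, but the difference of the two families is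
    -- eventually zero, and `l` acts linearly.
    rw [← sub_eq_zero]
    have : Sigma.desc (b i) ≫ K.map k - Sigma.desc (b i') =
        Sigma.desc fun j => b i j ≫ K.map k - b i' j := by
      ext j; simp
    rw [Category.assoc, ← Preadditive.comp_sub, this]
    refine hl _ _ ?_
    filter_upwards [Filter.eventually_ge_atTop i.unop] with j hj
    simp only [b, hj, hk.trans hj, dite_true, Category.assoc, ← K.map_comp, sub_eq_zero]
    congr 2
  let s : Cone K :=
    { pt := P
      π :=
        { app i := l ≫ Sigma.desc (b i)
          naturality i i' k := by
            rw [hcomp]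
            exact Category.id_comp _ } }
  refine ⟨hc.lift s, hd.hom_ext fun i => ?_⟩
  rw [Category.assoc, hf, hc.fac_assoc]
  have : Sigma.desc (b i) ≫ φ.app i = Sigma.desc fun j => b i j ≫ φ.app i := by
    ext j; simp
  change (l ≫ Sigma.desc (b i)) ≫ φ.app i = _
  rw [Category.assoc, this]
  refine hl _ _ ?_
  filter_upwards [Filter.eventually_ge_atTop i.unop] with j hj
  simp only [b, hj, dite_true, Category.assoc, φ.naturality, reassoc_of% hg, d.w]

end Lim

/-! ### The implications between the three conditions. -/

section Exactness

lemma lim_map_epi {C : Type u} [Category.{v} C] {J : Type*} [Category J] [HasLimitsOfShape J C]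
    [(lim : (J ⥤ C) ⥤ C).PreservesEpimorphisms] {K L : J ⥤ C} (φ : K ⟶ L) [Epi φ]
    {c : Cone K} (hc : IsLimit c) {d : Cone L} (hd : IsLimit d)
    (f : c.pt ⟶ d.pt) (hf : ∀ j, f ≫ d.π.app j = c.π.app j ≫ φ.app j) : Epi f := by
  refine ((MorphismProperty.epimorphisms C).arrow_mk_iso_iff ?_).2
    (inferInstance : Epi (lim.map φ))
  refine Arrow.isoMk (hc.conePointUniqueUpToIso (limit.isLimit _))
    (hd.conePointUniqueUpToIso (limit.isLimit _)) (limit.hom_ext fun j => ?_)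
  simp [hf]

open scoped Classical in
lemma ι_copowerToPower_π {C : Type u} [Category.{v} C] [HasZeroMorphisms C] (G : C) (X : Type v)
    [HasCoproduct fun _ : X => G] [HasProduct fun _ : X => G] (x y : X) :
    Sigma.ι (fun _ : X => G) x ≫ copowerToPower G X ≫ Pi.π (fun _ : X => G) y =
      if x = y then 𝟙 G else 0 := by
  simp [copowerToPower]

/-- Finiteness of `F` allows a retraction: the sum of the projections followed by the coprojections.
-/
lemma mono_sigmaDesc_comp_copowerToPower {C : Type u} [Category.{v} C] [Preadditive C] (G : C)
    {X : Type v} [HasCoproduct fun _ : X => G] [HasProduct fun _ : X => G] {F : Type v} [Finite F]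
    [HasCoproduct fun _ : F => G] {f : F → X} (hf : Function.Injective f) :
    Mono ((Sigma.desc fun i => Sigma.ι (fun _ : X => G) (f i)) ≫ copowerToPower G X) := by
  classical
  have := Fintype.ofFinite F
  refine (SplitMono.mk (∑ i, Pi.π (fun _ : X => G) (f i) ≫ Sigma.ι (fun _ : F => G) i) ?_).mono
  refine Sigma.hom_ext _ _ fun i => ?_
  have h (j : F) : Sigma.ι (fun _ : X => G) (f i) ≫ copowerToPower G X ≫
      Pi.π (fun _ : X => G) (f j) ≫ Sigma.ι (fun _ : F => G) j =
      if i = j then Sigma.ι (fun _ : F => G) j else 0 := by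
    have := ι_copowerToPower_π G X (f i) (f j) =≫ Sigma.ι (fun _ : F => G) j
    simp only [Category.assoc] at this
    rw [this]
    by_cases h : i = j <;> simp [h, hf.eq_iff]
  simp [Preadditive.comp_sum, h]

lemma epi_copowerToPower_comp_piLift {C : Type u} [Category.{v} C] [Preadditive C] (G : C)
    {X : Type v} [HasCoproduct fun _ : X => G] [HasProduct fun _ : X => G] {F : Type v} [Finite F]
    [HasProduct fun _ : F => G] {f : F → X} (hf : Function.Injective f) :
    Epi (copowerToPower G X ≫ Pi.lift fun i => Pi.π (fun _ : X => G) (f i)) := by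
  classical
  have := Fintype.ofFinite F
  refine (SplitEpi.mk (∑ i, Pi.π (fun _ : F => G) i ≫ Sigma.ι (fun _ : X => G) (f i)) ?_).epi
  refine Pi.hom_ext _ _ fun i => ?_
  simp [Preadditive.sum_comp, ι_copowerToPower_π, hf.eq_iff, comp_ite]

/-- The copower `J^(X)` is the filtered union of the finite copowers, which are subobjects of
`J^X`. -/
lemma mono_copowerToPower {A : Type u} [Category.{v} A] [Abelian A] [HasLimits A] [HasColimits A]
    [AB5 A] (J : A) (X : Type v) : Mono (copowerToPower J X) := by
  let φ := (CoproductsFromFiniteFiltered.finiteSubcoproductsCocone fun _ : X => J).ι ≫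
    (Functor.const _).map (copowerToPower J X)
  have (F : Finset (Discrete X)) : Mono (φ.app F) :=
    mono_sigmaDesc_comp_copowerToPower J (f := fun x : F => x.1.as)
      fun _ _ h => Subtype.ext (Discrete.ext h)
  have := NatTrans.mono_of_mono_app φ
  have := IsFiltered.isConnected (Finset (Discrete X))
  exact colim.map_mono' φ
    (CoproductsFromFiniteFiltered.isColimitFiniteSubproductsCocone fun _ : X => J)
    (isColimitConstCocone _ _) (copowerToPower J X) fun F => (Category.comp_id _).symm

/-- The power `P^X` is the cofiltered limit of the finite powers, which are quotients of
`P^(X)`. -/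
lemma epi_copowerToPower {B : Type u} [Category.{v} B] [Abelian B] [HasLimits B] [HasColimits B]
    [AB5Star B] (P : B) (X : Type v) : Epi (copowerToPower P X) := by
  let φ := (Functor.const _).map (copowerToPower P X) ≫
    (ProductsFromFiniteCofiltered.finiteSubproductsCone fun _ : X => P).π
  have (F : (Finset (Discrete X))ᵒᵖ) : Epi (φ.app F) :=
    epi_copowerToPower_comp_piLift P (f := fun x : F.unop => x.1.as)
      fun _ _ h => Subtype.ext (Discrete.ext h)
  have := NatTrans.epi_of_epi_app φ
  have := IsCofiltered.isConnected (Finset (Discrete X))ᵒᵖ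
  exact lim_map_epi φ (isLimitConstCone _ _)
    (ProductsFromFiniteCofiltered.isLimitFiniteSubproductsCone fun _ : X => P)
    (copowerToPower P X) fun F => (Category.id_comp _).symm

lemma HasSummation.ab5Star {B : Type u} [Category.{v} B] [Abelian B] [HasLimits B]
    [HasColimits B] {P : B} [Projective P] (hP : HasSummation P) (hsep : IsSeparator P) :
    AB5Star B where
  ofShape J _ _ := by
    -- An initial functor from the opposite of a directed set reduces cofiltered limits to inverse
    -- systems, where only preservation of epimorphisms is at stake.
    obtain ⟨I, _, _, _, F, _⟩ := IsFiltered.exists_directed Jᵒᵖ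
    have : HasExactLimitsOfShape Iᵒᵖ B := by
      have : (lim : (Iᵒᵖ ⥤ B) ⥤ B).PreservesEpimorphisms :=
        ⟨fun φ _ => hP.epi_of_isLimit hsep φ (limit.isLimit _) (limit.isLimit _) _ fun i => by simp⟩
      exact hasExactLimitsOfShape_of_preservesEpi B Iᵒᵖ
    exact hasExactLimitsOfShape_of_initial B F.leftOp

lemma HasSummation.ab5_of_op {A : Type u} [Category.{v} A] [Abelian A] [HasLimits A]
    [HasColimits A] {J : A} [Injective J] (hJ : HasSummation (op J)) (hsep : IsCoseparator J) :
    AB5 A where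
  ofShape K _ _ := by
    obtain ⟨I, _, _, _, F, _⟩ := IsFiltered.exists_directed K
    have : HasExactColimitsOfShape I A := by
      have : (colim : (I ⥤ A) ⥤ A).PreservesMonomorphisms := by
        refine ⟨fun {G H} φ _ => ?_⟩
        have (i : Iᵒᵖ) : Epi ((NatTrans.op φ).app i) := by dsimp; infer_instance
        have : Epi (colim.map φ).op :=
          hJ.epi_of_isLimit ((isSeparator_op_iff _).2 hsep) (NatTrans.op φ)
            (colimit.isColimit H).op (colimit.isColimit G).op _ fun i =>
              Quiver.Hom.unop_inj (by simp)
        exact (op_epi_iff _).1 this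
      exact hasExactColimitsOfShape_of_preservesMono A I
    exact hasExactColimitsOfShape_of_final A F

lemma HasSummation.of_factors {C : Type u} [Category.{v} C] [Preadditive C] [HasCoproducts.{v} C]
    [HasProducts.{v} C] {P : C}
    (h : ∀ X : Type v, ∃ t : P ⟶ (∐ fun _ : X => P), t ≫ copowerToPower P X = diagonalToPower P X) :
    HasSummation P := fun X =>
  (h X).imp fun _ ht _ x a => comp_sigmaDesc_single ht x a

open scoped Classical in
lemma HasSummation.op_of_factors {C : Type u} [Category.{v} C] [Preadditive C]
    [HasCoproducts.{v} C] [HasProducts.{v} C] {J : C}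
    (h : ∀ X : Type v, ∃ r : (∏ᶜ fun _ : X => J) ⟶ J,
      copowerToPower J X ≫ r = copowerSummation J X) :
    HasSummation (op J) := by
  intro X
  obtain ⟨r, hr⟩ := h X
  -- The power of `J` becomes the copower of `op J`, so `r` itself is the summation operation.
  refine ⟨r.op ≫ (opProductIsoCoproduct _).hom, fun D x a => ?_⟩
  have key : Pi.lift (fun y => (Pi.single x a : X → (op J ⟶ D)) y |>.unop) =
      a.unop ≫ Sigma.ι (fun _ : X => J) x ≫ copowerToPower J X := by
    refine Pi.hom_ext _ _ fun y => ?_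
    by_cases h : y = x
    · subst h
      simp [ι_copowerToPower_π]
    · simp [ι_copowerToPower_π, h, Ne.symm h]
  have hdesc : (opProductIsoCoproduct fun _ : X => J).hom ≫
      Sigma.desc (Pi.single x a : X → (op J ⟶ D)) =
      (Pi.lift fun y => (Pi.single x a : X → (op J ⟶ D)) y |>.unop).op := by
    rw [← Iso.eq_inv_comp]
    ext y
    have : Sigma.ι (fun _ : X => op J) y ≫ (opProductIsoCoproduct fun _ : X => J).inv =
        (Pi.π (fun _ : X => J) y).op := by
      rw [Iso.comp_inv_eq, π_comp_opProductIsoCoproduct_hom]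
    rw [Sigma.ι_desc, reassoc_of% this, ← op_comp, Pi.lift_π, Quiver.Hom.op_unop]
  rw [Category.assoc, hdesc, key, ← op_comp, Category.assoc, Category.assoc, hr]
  simp [copowerSummation]

end Exactness

/-! ### Existence of the remaining limits and colimits. -/

section Complete

lemma hasLimits_of_isSeparator {B : Type u} [Category.{v} B] [Abelian B] [HasCoproducts.{v} B]
    {P : B} (hP : IsSeparator P) : HasLimits B := by
  have : HasColimits B := has_colimits_of_hasCoequalizers_and_coproducts
  have : HasSeparator B := ⟨⟨P, hP⟩⟩
  exact hasLimits_of_hasColimits_of_hasSeparator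

lemma hasColimits_of_isCoseparator {A : Type u} [Category.{v} A] [Abelian A] [HasProducts.{v} A]
    {J : A} (hJ : IsCoseparator J) : HasColimits A := by
  have : HasLimits A := has_limits_of_hasEqualizers_and_products
  have : HasSeparator Aᵒᵖ := ⟨⟨op J, (isSeparator_op_iff _).2 hJ⟩⟩
  -- Well-poweredness comes from the separator `op J` of the opposite category, by way of the double
  -- opposite.
  have : WellPowered.{v} A := wellPowered_of_equiv.{v} (opOpEquivalence A)
  have : HasCoseparator A := ⟨⟨J, hJ⟩⟩
  exact hasColimits_of_hasLimits_of_hasCoseparator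

end Complete

/-- Cofiltered limits in a cocomplete abelian category with a projective generator, and dually
filtered colimits in a complete abelian category with an injective cogenerator. "Complete" in the
first part and "cocomplete" in the second part belong to the conclusion. -/
theorem theorem3p3 :
    (∀ (B : Type u) [Category.{v} B] [Abelian B] [HasCoproducts.{v} B] (P : B),
      Projective P → IsSeparator P →
        ∃ _ : HasLimits B,
          List.TFAE
            [AB5Star B,
             ∀ X : Type v, Epi (copowerToPower P X),
             ∀ X : Type v, ∃ s : P ⟶ (∐ fun _ : X => P),
               s ≫ copowerToPower P X = diagonalToPower P X]) ∧
    (∀ (A : Type u) [Category.{v} A] [Abelian A] [HasProducts.{v} A] (J : A),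
      Injective J → IsCoseparator J →
        ∃ _ : HasColimits A,
          List.TFAE
            [AB5 A,
             ∀ X : Type v, Mono (copowerToPower J X),
             ∀ X : Type v, ∃ r : (∏ᶜ fun _ : X => J) ⟶ J,
               copowerToPower J X ≫ r = copowerSummation J X]) := by
  refine ⟨fun B _ _ _ P _ hP => ?_, fun A _ _ _ J _ hJ => ?_⟩
  · have := hasLimits_of_isSeparator hP
    have : HasColimits B := has_colimits_of_hasCoequalizers_and_coproducts
    refine ⟨inferInstance, ?_⟩
    tfae_have 1 → 2 := fun _ X => epi_copowerToPower P X
    tfae_have 2 → 3 := fun h X => have := h X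
      ⟨Projective.factorThru (diagonalToPower P X) (copowerToPower P X), Projective.factorThru_comp _ _⟩
    tfae_have 3 → 1 := fun h => (HasSummation.of_factors h).ab5Star hP
    tfae_finish
  · have := hasColimits_of_isCoseparator hJ
    have : HasLimits A := has_limits_of_hasEqualizers_and_products
    refine ⟨inferInstance, ?_⟩
    tfae_have 1 → 2 := fun _ X => mono_copowerToPower J X
    tfae_have 2 → 3 := fun h X => have := h X
      ⟨Injective.factorThru (copowerSummation J X) (copowerToPower J X), Injective.comp_factorThru _ _⟩
    tfae_have 3 → 1 := fun h => (HasSummation.op_of_factors h).ab5_of_op hJ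
    tfae_finish
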